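/- Let $G$ be a (real) Lie group, $V$ an $n$-dimensional real vector space, and $\Phi:G\to \mathrm{Aut}(V)$ a representation, i.e. a smooth group homomorphism. Equip the tangent bundle $TV$ with the $2n$-dimensional vector space structure $$X\oplus Y=(T\tau_y)X+(T\tau_x)Y,\qquad \lambda\bullet X=(T\sigma_\lambda)X\qquad (X\in T_xV,\ Y\in T_yV,\ \lambda\in\mathbb{R}),$$ where $\tau_x$ is the translation by $x$ and $\sigma_\lambda$ the multiplication by $\lambda$ on $V$. Fix a basis $\alpha_1,\dots,\alpha_n$ of $V$ with coordinate functions $x_1,\dots,x_n$, let $\psi:TV\to V\times\mathbb{R}^n$, $\psi(Y_p)=(p,(Y_p[x_1],\dots,Y_p[x_n]))$ for $Y_p\in T_pV$, be the induced linear trivialization, and give $TV$ the basis $\psi^{-1}(\alpha_1,0),\dots,\psi^{-1}(\alpha_n,0),\psi^{-1}(0,e_1),\dots,\psi^{-1}(0,e_n)$. Let $Z:\mathrm{Aut}(V)\to GL(n,\mathbb{R})$ and $\breve Z:\mathrm{Aut}(TV)\to GL(2n,\mathbb{R})$ be the isomorphisms that send an automorphism to its matrix in these bases, and let $$J_n:T(GL(n,\mathbb{R}))\to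 GL(2n,\mathbb{R}),\qquad J_n(Y)=\begin{pmatrix} a&0\\ Ba&a\end{pmatrix}\quad\text{for } Y\in T_aGL(n,\mathbb{R}),\ B=TR_{a^{-1}}(Y)\in \mathrm{Lie}(GL(n,\mathbb{R})),$$ with $R_{a^{-1}}$ the right translation by $a^{-1}$. The prolongation of $\Phi$ is $\widetilde\Phi=\breve Z^{-1}\circ J_n\circ TZ\circ T\Phi:TG\to \mathrm{Aut}(TV)$. Let $U\subseteq V$ be a linear subspace, and regard $TU$ as a linear subspace of $TV$ through the differential of the inclusion $U\hookrightarrow V$. Then $U$ is invariant for $\Phi$ (that is, $\Phi(a)(U)\subseteq U$ for all $a\in G$) if and only if $TU$ is invariant for $\widetilde\Phi$ (that is, $\widetilde\Phi(X)(TU)\subseteq TU$ for all $X\in TG$). -/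

import Mathlib

open scoped Manifold ContDiff Bundle

noncomputable section

namespace Prolongation

instance completeSpace_end {V : Type*} [NormedAddCommGroup V] [NormedSpace ℝ V]
    [FiniteDimensional ℝ V] : CompleteSpace (V →L[ℝ] V) :=
  FiniteDimensional.complete ℝ _

/-- The algebra of real `n × n` matrices, as a type of its own, to be equipped with a norm. -/
def Mat (n : ℕ) : Type := Matrix (Fin n) (Fin n) ℝ

/-- The `ℓ^∞` operator norm on matrices; the choice of a norm does not affect the smooth
structure on `GL(n, ℝ)`. -/
instance (n : ℕ) : NormedRing (Mat n) :=
  (Matrix.linftyOpNormedRing : NormedRing (Matrix (Fin n) (Fin n) ℝ))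

instance (n : ℕ) : NormedAlgebra ℝ (Mat n) :=
  letI : NormedRing (Matrix (Fin n) (Fin n) ℝ) := Matrix.linftyOpNormedRing
  (Matrix.linftyOpNormedAlgebra : NormedAlgebra ℝ (Matrix (Fin n) (Fin n) ℝ))

instance (n : ℕ) : FiniteDimensional ℝ (Mat n) :=
  (inferInstance : FiniteDimensional ℝ (Matrix (Fin n) (Fin n) ℝ))

instance (n : ℕ) : CompleteSpace (Mat n) :=
  FiniteDimensional.complete ℝ _

/-- The identity map from matrices to `Mat n`. -/
def toMat (n : ℕ) : Matrix (Fin n) (Fin n) ℝ ≃* Mat n where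
  toFun A := A
  invFun A := A
  left_inv _ := rfl
  right_inv _ := rfl
  map_mul' _ _ := rfl

/-- The Lie group `GL(n, ℝ)`, an open subset of the space of matrices. -/
abbrev GLn (n : ℕ) : Type := (Mat n)ˣ

/-- The tangent bundle `TV` of a normed space `V`, seen as a manifold. -/
abbrev TV (V : Type*) [NormedAddCommGroup V] [NormedSpace ℝ V] : Type _ :=
  TangentBundle 𝓘(ℝ, V) V

/-- The automorphism group `Aut(V)` of a finite-dimensional real vector space, with its Lie group
structure as an open subset of the space of endomorphisms (all of them are continuous). -/
abbrev Aut (V : Type*) [NormedAddCommGroup V] [NormedSpace ℝ V] : Type _ :=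
  (V →L[ℝ] V)ˣ

section VectorSpaceStructure

variable {V : Type*} [NormedAddCommGroup V] [NormedSpace ℝ V]

/-- `X ⊕ Y = (Tτ_y) X + (Tτ_x) Y` for `X ∈ T_x V` and `Y ∈ T_y V`, with `τ` the translations;
the sum on the right is taken in `T_{x+y} V`. -/
instance : Add (TV V) where
  add X Y := ⟨X.proj + Y.proj, HAdd.hAdd (α := TangentSpace 𝓘(ℝ, V) (X.proj + Y.proj))
    (mfderiv 𝓘(ℝ, V) 𝓘(ℝ, V) (fun z : V => z + Y.proj) X.proj X.snd)
    (mfderiv 𝓘(ℝ, V) 𝓘(ℝ, V) (fun z : V => X.proj + z) Y.proj Y.snd)⟩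

/-- `c • X = (Tσ_c) X`, with `σ_c` the scalar multiplication by `c` on `V`. -/
instance : SMul ℝ (TV V) where
  smul c X := tangentMap 𝓘(ℝ, V) 𝓘(ℝ, V) (fun z : V => c • z) X

/-- The zero vector of `TV`: the zero tangent vector at the origin. -/
instance : Zero (TV V) where
  zero := ⟨0, (0 : V)⟩

/-- The opposite of `X` is `(Tσ_{-1}) X`. -/
instance : Neg (TV V) where
  neg X := (-1 : ℝ) • X

/-- The principal part of a tangent vector of `V`. -/
def vec (X : TV V) : V := X.snd

theorem add_def (X Y : TV V) : X + Y = ⟨X.proj + Y.proj, vec X + vec Y⟩ := by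
  change (⟨X.proj + Y.proj, _⟩ : TV V) = _
  congr 1
  rw [mfderiv_eq_fderiv, mfderiv_eq_fderiv, fderiv_add_const, fderiv_const_add]
  simp
  rfl

theorem smul_def (c : ℝ) (X : TV V) :
    c • X = ⟨c • X.proj, c • vec X⟩ := by
  change (⟨c • X.proj, mfderiv 𝓘(ℝ, V) 𝓘(ℝ, V) (fun z : V => c • z) X.proj X.snd⟩ : TV V) = _
  congr 1
  rw [mfderiv_eq_fderiv]
  have h : HasFDerivAt (fun z : V => c • z) (c • ContinuousLinearMap.id ℝ V) X.proj :=
    (hasFDerivAt_id X.proj).const_smul c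
  rw [h.fderiv]
  rfl

/-- The bijection `TV ≃ V × V`, used to verify the vector space axioms. -/
def toProd : TV V ≃ V × V where
  toFun X := (X.proj, X.snd)
  invFun q := ⟨q.1, q.2⟩
  left_inv _ := rfl
  right_inv _ := rfl

theorem toProd_add (X Y : TV V) : toProd (X + Y) = toProd X + toProd Y := by
  rw [add_def]; rfl

theorem toProd_smul (c : ℝ) (X : TV V) : toProd (c • X) = c • toProd X := by
  rw [smul_def]; rfl

theorem toProd_zero : toProd (0 : TV V) = 0 := rfl

theorem toProd_neg (X : TV V) : toProd (-X) = -toProd X := by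
  change toProd ((-1 : ℝ) • X) = _
  rw [toProd_smul, neg_one_smul]

instance : AddCommGroup (TV V) where
  add_assoc X Y Z := toProd.injective (by simp only [toProd_add, add_assoc])
  zero_add X := toProd.injective (by simp only [toProd_add, toProd_zero, zero_add])
  add_zero X := toProd.injective (by simp only [toProd_add, toProd_zero, add_zero])
  nsmul := nsmulRec
  zsmul := zsmulRec
  neg_add_cancel X := toProd.injective (by
    simp only [toProd_add, toProd_neg, toProd_zero, neg_add_cancel])
  add_comm X Y := toProd.injective (by simp only [toProd_add, add_comm])

/-- The `2n`-dimensional vector space structure on the tangent bundle `TV`. -/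
instance : Module ℝ (TV V) where
  one_smul X := toProd.injective (by simp only [toProd_smul, one_smul])
  mul_smul c d X := toProd.injective (by simp only [toProd_smul, mul_smul])
  smul_zero c := toProd.injective (by simp only [toProd_smul, toProd_zero, smul_zero])
  smul_add c X Y := toProd.injective (by simp only [toProd_smul, toProd_add, smul_add])
  add_smul c d X := toProd.injective (by simp only [toProd_smul, toProd_add, add_smul])
  zero_smul X := toProd.injective (by simp only [toProd_smul, toProd_zero, zero_smul])

/-- The differential of a continuous linear map `f : V → W` is linear from `TV` to `TW`. -/
def tangentLinearMap {W : Type*} [NormedAddCommGroup W] [NormedSpace ℝ W] (f : V →L[ℝ] W) :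
    TV V →ₗ[ℝ] TV W where
  toFun := tangentMap 𝓘(ℝ, V) 𝓘(ℝ, W) f
  map_add' X Y := toProd.injective (by
    rw [toProd_add, add_def]
    simp only [tangentMap, mfderiv_eq_fderiv, ContinuousLinearMap.fderiv]
    exact Prod.ext (map_add f _ _) (map_add f _ _))
  map_smul' c X := toProd.injective (by
    rw [toProd_smul, smul_def]
    simp only [tangentMap, mfderiv_eq_fderiv, ContinuousLinearMap.fderiv]
    exact Prod.ext (map_smul f _ _) (map_smul f _ _))

/-- The tangent bundle `TU` of a subspace `U ⊆ V`, seen as a subspace of `TV` through the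
differential of the inclusion `U → V`. -/
def tangentSubspace (U : Submodule ℝ V) : Submodule ℝ (TV V) :=
  LinearMap.range (tangentLinearMap U.subtypeL)

end VectorSpaceStructure

/-- A subspace `U` is invariant for a family `Ψ` of linear operators (for instance for a
representation) if all of these operators map `U` into itself. -/
def IsInvariantSubspace {S W : Type*} [AddCommGroup W] [Module ℝ W] (Ψ : S → (W →ₗ[ℝ] W))
    (U : Submodule ℝ W) : Prop :=
  ∀ s : S, ∀ p ∈ U, Ψ s p ∈ U

section Prolong

variable {n : ℕ} {V : Type*} [NormedAddCommGroup V] [NormedSpace ℝ V] [FiniteDimensional ℝ V]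

/-- The derivative `X[x_i]` of the `i`-th coordinate function of `V` in the basis `b` along the
tangent vector `X`. -/
def coordDeriv (b : Module.Basis (Fin n) ℝ V) (X : TV V) (i : Fin n) : ℝ :=
  mfderiv 𝓘(ℝ, V) 𝓘(ℝ, ℝ) (fun p : V => b.repr p i) X.proj X.snd

theorem coordDeriv_eq (b : Module.Basis (Fin n) ℝ V) (X : TV V) :
    coordDeriv b X = b.equivFun (vec X) := by
  funext i
  have h : (fun p : V => b.repr p i) = (b.coord i).toContinuousLinearMap := rfl
  rw [coordDeriv, mfderiv_eq_fderiv, h, ContinuousLinearMap.fderiv]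
  rfl

/-- The bundle trivialization `ψ : TV → V × ℝⁿ`, `Y_p ↦ (p, (Y_p[x_1], …, Y_p[x_n]))`, where
`x_1, …, x_n` are the coordinate functions of `V` in the basis `b`. -/
def psi (b : Module.Basis (Fin n) ℝ V) : TV V ≃ₗ[ℝ] V × (Fin n → ℝ) where
  toFun X := (X.proj, coordDeriv b X)
  invFun q := ⟨q.1, b.equivFun.symm q.2⟩
  map_add' X Y := by
    simp only [coordDeriv_eq, add_def]
    exact Prod.ext rfl (map_add b.equivFun (vec X) (vec Y))
  map_smul' c X := by
    simp only [coordDeriv_eq, smul_def]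
    exact Prod.ext rfl (map_smul b.equivFun c (vec X))
  left_inv X := by
    simp only [coordDeriv_eq, LinearEquiv.symm_apply_apply]
    rfl
  right_inv q := by
    simp only [coordDeriv_eq]
    exact Prod.ext rfl (b.equivFun.apply_symm_apply q.2)

/-- The basis `(α̃_1, …, α̃_n, ỹ_1, …, ỹ_n)` of `TV` with `α̃_i = ψ⁻¹(α_i, 0)` and
`ỹ_i = ψ⁻¹(0, e_i)`, where `b = (α_1, …, α_n)`. -/
def tangentBasis (b : Module.Basis (Fin n) ℝ V) : Module.Basis (Fin n ⊕ Fin n) ℝ (TV V) :=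
  (b.prod (Pi.basisFun ℝ (Fin n))).map (psi b).symm

/-- The isomorphism `Z : Aut(V) → GL(n, ℝ)` sending an automorphism to its matrix in the
basis `b`. -/
def Z (b : Module.Basis (Fin n) ℝ V) : Aut V →* GLn n :=
  Units.map (((toMat n).toMonoidHom.comp
    (LinearMap.toMatrixAlgEquiv b).toMulEquiv.toMonoidHom).comp
    ((ContinuousLinearMap.toLinearMapRingHom : (V →L[ℝ] V) →+* (V →ₗ[ℝ] V)) :
      (V →L[ℝ] V) →* (V →ₗ[ℝ] V)))

/-- The isomorphism `Z̆ : Aut(TV) → GL(2n, ℝ)` sending an automorphism of `TV` to its matrix in the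
basis `tangentBasis b`. -/
def Zbreve (b : Module.Basis (Fin n) ℝ V) :
    LinearMap.GeneralLinearGroup ℝ (TV V) ≃* GL (Fin n ⊕ Fin n) ℝ :=
  Units.mapEquiv (LinearMap.toMatrixAlgEquiv (tangentBasis b)).toMulEquiv

/-- For `Y ∈ T_a GL(n, ℝ)`, the element `B = TR_{a⁻¹}(Y)` of `Lie(GL(n, ℝ))`, so that
`Y = [a, B]`. As `GL(n, ℝ)` is open in the space of matrices, `B` is a matrix. -/
def lieComponent (Y : TangentBundle 𝓘(ℝ, Mat n) (GLn n)) : Mat n :=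
  mfderiv 𝓘(ℝ, Mat n) 𝓘(ℝ, Mat n) (fun y : GLn n => y * Y.proj⁻¹) Y.proj Y.snd

/-- The embedding `J_n : T(GL(n, ℝ)) → GL(2n, ℝ)` sending `[a, B]` to the block matrix with rows
`(a, 0)` and `(B a, a)`. -/
def J (Y : TangentBundle 𝓘(ℝ, Mat n) (GLn n)) : GL (Fin n ⊕ Fin n) ℝ where
  val := Matrix.fromBlocks ((toMat n).symm Y.proj.val) 0
    ((toMat n).symm (lieComponent Y * Y.proj.val)) ((toMat n).symm Y.proj.val)
  inv := Matrix.fromBlocks ((toMat n).symm Y.proj.inv) 0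
    (-(toMat n).symm (Y.proj.inv * lieComponent Y)) ((toMat n).symm Y.proj.inv)
  val_inv := by
    have h : (toMat n).symm Y.proj.val * (toMat n).symm Y.proj.inv = 1 := by
      rw [← map_mul, Y.proj.val_inv, map_one]
    rw [Matrix.fromBlocks_multiply, map_mul, map_mul]
    simp only [Matrix.mul_neg, ← Matrix.mul_assoc, h]
    rw [Matrix.mul_assoc _ _ ((toMat n).symm Y.proj.inv), h]
    simp [Matrix.fromBlocks_one]
  inv_val := by
    have h : (toMat n).symm Y.proj.inv * (toMat n).symm Y.proj.val = 1 := by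
      rw [← map_mul, Y.proj.inv_val, map_one]
    rw [Matrix.fromBlocks_multiply, map_mul, map_mul]
    simp only [Matrix.neg_mul, ← Matrix.mul_assoc, h]
    simp [Matrix.fromBlocks_one]

/-- The prolongation `Φ̃ = Z̆⁻¹ ∘ J_n ∘ TZ ∘ TΦ : TG → Aut(TV)` of a representation
`Φ : G → Aut(V)`. -/
def prolongation {E : Type*} [NormedAddCommGroup E] [NormedSpace ℝ E] {H : Type*}
    [TopologicalSpace H] {I : ModelWithCorners ℝ E H} {G : Type*} [TopologicalSpace G]
    [ChartedSpace H G] [Group G] (b : Module.Basis (Fin n) ℝ V)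
    (Φ : ContMDiffMonoidMorphism I 𝓘(ℝ, V →L[ℝ] V) ∞ G (Aut V)) (X : TangentBundle I G) :
    LinearMap.GeneralLinearGroup ℝ (TV V) :=
  (Zbreve b).symm (J (tangentMap 𝓘(ℝ, V →L[ℝ] V) 𝓘(ℝ, Mat n) (Z b)
    (tangentMap I 𝓘(ℝ, V →L[ℝ] V) Φ X)))

end Prolong

end Prolongation

end

/-!
In the splitting `TV = V × V`, the operator that the prolongation attaches to a tangent vector
`Y ∈ T_a Aut(V)` is `(p, v) ↦ (a p, Y p + a v)`, and `TU = U × U`. If all `Φ(a)` preserve `U`, then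
for `p ∈ U` the map `a ↦ Φ(a) p` takes values in the closed subspace `U`, and so do its derivatives
`Y p`; the converse is seen on the first component, with `Y` over `Φ(a)`.
-/

namespace Prolongation

section Differential

variable {𝕜 : Type*} [NontriviallyNormedField 𝕜]
  {E : Type*} [NormedAddCommGroup E] [NormedSpace 𝕜 E] {H : Type*} [TopologicalSpace H]
  {I : ModelWithCorners 𝕜 E H} {M : Type*} [TopologicalSpace M] [ChartedSpace H M]

variable {F : Type*} [NormedAddCommGroup F] [NormedSpace 𝕜 F] {U : Submodule 𝕜 F}

theorem mfderiv_apply_mem_of_eventually_mem (hU : IsClosed (U : Set F)) {f : M → F} {x : M}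
    (hf : MDifferentiableAt I 𝓘(𝕜, F) f x) (hfU : ∀ᶠ y in nhds x, f y ∈ U)
    (v : TangentSpace I x) :
    (mfderiv I 𝓘(𝕜, F) f x v : F) ∈ U := by
  have hcomp := U.mkQL.hasMFDerivAt.comp x hf.hasMFDerivAt
  have hzero : (U.mkQL ∘ f) =ᶠ[nhds x] fun _ => 0 :=
    hfU.mono fun y hy => (Submodule.Quotient.mk_eq_zero U).2 hy
  have hderiv := hasMFDerivAt_unique hcomp
    ((hasMFDerivAt_const (0 : F ⧸ U) x).congr_of_eventuallyEq hzero)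
  exact (Submodule.Quotient.mk_eq_zero U).1 (DFunLike.congr_fun hderiv v)

variable {R : Type*} [NormedRing R] [NormedAlgebra 𝕜 R] [CompleteSpace R]

/-- The principal part of a tangent vector of the group of units of a normed algebra `R`: as `Rˣ`
is open in `R`, its tangent spaces are copies of `R`. -/
def unitsVec (Y : TangentBundle 𝓘(𝕜, R) Rˣ) : R := Y.snd

theorem hasMFDerivAt_units_val (u : Rˣ) :
    HasMFDerivAt 𝓘(𝕜, R) 𝓘(𝕜, R) (Units.val : Rˣ → R) u (ContinuousLinearMap.id 𝕜 R) := by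
  have hid : mfderiv 𝓘(𝕜, R) 𝓘(𝕜, R) (chartAt R u) u = ContinuousLinearMap.id 𝕜 R := by
    rw [mfderiv_chartAt_eq_tangentCoordChange (mem_chart_source R u)]
    exact ContinuousLinearMap.ext fun _ => tangentCoordChange_self (mem_extChartAt_source u)
  -- `Units.val` is, definitionally, the chart of `Rˣ` at every point.
  exact hid ▸ hasMFDerivAt_extChartAt (I := 𝓘(𝕜, R)) (mem_chart_source R u)

theorem unitsVec_tangentMap {f : M → Rˣ} {X : TangentBundle I M}
    (hf : MDifferentiableAt I 𝓘(𝕜, R) f X.proj) :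
    unitsVec (tangentMap I 𝓘(𝕜, R) f X) =
      mfderiv I 𝓘(𝕜, R) (fun y => (f y : R)) X.proj X.snd :=
  (DFunLike.congr_fun
    ((hasMFDerivAt_units_val (f X.proj)).comp X.proj hf.hasMFDerivAt).mfderiv X.snd).symm

theorem unitsVec_tangentMap_of_val_eq {S : Type*} [NormedRing S] [NormedAlgebra 𝕜 S]
    [CompleteSpace S] {f : Rˣ → Sˣ} {L : R →L[𝕜] S} (hf : ∀ u, (f u : S) = L u)
    (Y : TangentBundle 𝓘(𝕜, R) Rˣ) :
    unitsVec (tangentMap 𝓘(𝕜, R) 𝓘(𝕜, S) f Y) = L (unitsVec Y) := by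
  have hval : (fun u => (f u : S)) = L ∘ Units.val := funext hf
  have hsmooth : ContMDiff 𝓘(𝕜, R) 𝓘(𝕜, S) 1 f := by
    apply ContMDiff.of_comp_isOpenEmbedding Units.isOpenEmbedding_val
    exact (L.contMDiff.comp Units.contMDiff_val).congr hf
  rw [unitsVec_tangentMap (hsmooth.mdifferentiableAt one_ne_zero), hval,
    (L.hasMFDerivAt.comp Y.proj (hasMFDerivAt_units_val Y.proj)).mfderiv]
  rfl

theorem map_unitsVec_tangentMap_mem_of_eventually_mem (hU : IsClosed (U : Set F)) (L : R →L[𝕜] F)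
    {f : M → Rˣ} {X : TangentBundle I M} (hf : MDifferentiableAt I 𝓘(𝕜, R) f X.proj)
    (hfU : ∀ᶠ y in nhds X.proj, L (f y) ∈ U) :
    L (unitsVec (tangentMap I 𝓘(𝕜, R) f X)) ∈ U := by
  have hval := (hasMFDerivAt_units_val (f X.proj)).comp X.proj hf.hasMFDerivAt
  have hLf := L.hasMFDerivAt.comp X.proj hval
  have hmem := mfderiv_apply_mem_of_eventually_mem hU hLf.mdifferentiableAt hfU X.snd
  rw [hLf.mfderiv] at hmem
  exact hmem

end Differential

section TangentBundleOfVectorSpace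

variable {V W : Type*} [NormedAddCommGroup V] [NormedSpace ℝ V]
  [NormedAddCommGroup W] [NormedSpace ℝ W]

theorem tangentLinearMap_apply (f : V →L[ℝ] W) (P : TV V) :
    tangentLinearMap f P = (⟨f P.proj, f (vec P)⟩ : TV W) := by
  change tangentMap 𝓘(ℝ, V) 𝓘(ℝ, W) f P = _
  simp only [tangentMap, mfderiv_eq_fderiv, ContinuousLinearMap.fderiv]
  rfl

theorem mem_tangentSubspace {U : Submodule ℝ V} {P : TV V} :
    P ∈ tangentSubspace U ↔ P.proj ∈ U ∧ vec P ∈ U := by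
  constructor
  · rintro ⟨Q, rfl⟩
    rw [tangentLinearMap_apply]
    exact ⟨Q.proj.2, (vec Q).2⟩
  · rintro ⟨hproj, hvec⟩
    exact ⟨⟨⟨P.proj, hproj⟩, (⟨vec P, hvec⟩ : U)⟩, tangentLinearMap_apply _ _⟩

variable {n : ℕ} [FiniteDimensional ℝ V]

theorem tangentBasis_repr (b : Module.Basis (Fin n) ℝ V) (P : TV V) :
    ⇑((tangentBasis b).repr P) = Sum.elim (b.repr P.proj) (b.repr (vec P)) := by
  have hpsi : psi b P = (P.proj, b.equivFun (vec P)) := by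
    rw [← coordDeriv_eq]
    rfl
  funext i
  rcases i with i | i <;> simp [tangentBasis, hpsi]

theorem toLin_tangentBasis_fromBlocks (b : Module.Basis (Fin n) ℝ V) (f₁₁ f₁₂ f₂₁ f₂₂ : V →ₗ[ℝ] V)
    (P : TV V) :
    Matrix.toLin (tangentBasis b) (tangentBasis b)
        (Matrix.fromBlocks (LinearMap.toMatrix b b f₁₁) (LinearMap.toMatrix b b f₁₂)
          (LinearMap.toMatrix b b f₂₁) (LinearMap.toMatrix b b f₂₂)) P =
      (⟨f₁₁ P.proj + f₁₂ (vec P), (f₂₁ P.proj + f₂₂ (vec P) : V)⟩ : TV V) := by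
  apply (tangentBasis b).repr.injective
  apply DFunLike.coe_injective
  simp only [Matrix.repr_toLin, tangentBasis_repr, Matrix.fromBlocks_mulVec, Sum.elim_comp_inl,
    Sum.elim_comp_inr, LinearMap.toMatrix_mulVec_repr, ← Finsupp.coe_add, ← map_add]
  rfl

end TangentBundleOfVectorSpace

section AutProlongation

variable {n : ℕ}

theorem lieComponent_mul_val (Y : TangentBundle 𝓘(ℝ, Mat n) (GLn n)) :
    lieComponent Y * Y.proj.val = unitsVec Y := by
  have hright : lieComponent Y = unitsVec Y * (Y.proj⁻¹ : GLn n) :=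
    unitsVec_tangentMap_of_val_eq (f := fun y : GLn n => y * Y.proj⁻¹)
      (L := (ContinuousLinearMap.mul ℝ (Mat n)).flip (Y.proj⁻¹ : GLn n)) (fun _ => rfl) Y
  rw [hright, Units.inv_mul_cancel_right]

variable {V : Type*} [NormedAddCommGroup V] [NormedSpace ℝ V] [FiniteDimensional ℝ V]

/-- The matrix of an endomorphism in the basis `b`, as a continuous linear map. It extends `Z b`
from the open subset `Aut V` to all endomorphisms, hence is the differential of `Z b`. -/
noncomputable def toMatCLM (b : Module.Basis (Fin n) ℝ V) : (V →L[ℝ] V) →L[ℝ] Mat n :=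
  LinearMap.toContinuousLinearMap (F' := Mat n)
    ((LinearMap.toMatrix b b).toLinearMap ∘ₗ ContinuousLinearMap.coeLM ℝ)

theorem J_tangentMap_Z (b : Module.Basis (Fin n) ℝ V)
    (Y : TangentBundle 𝓘(ℝ, V →L[ℝ] V) (Aut V)) :
    (J (tangentMap 𝓘(ℝ, V →L[ℝ] V) 𝓘(ℝ, Mat n) (Z b) Y) : Matrix (Fin n ⊕ Fin n) _ ℝ) =
      Matrix.fromBlocks (LinearMap.toMatrix b b (Y.proj : V →L[ℝ] V)) 0
        (LinearMap.toMatrix b b (unitsVec Y : V →L[ℝ] V))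
        (LinearMap.toMatrix b b (Y.proj : V →L[ℝ] V)) := by
  have hvec := unitsVec_tangentMap_of_val_eq (f := Z b) (L := toMatCLM b) (fun _ => rfl) Y
  change Matrix.fromBlocks _ _ _ _ = _
  rw [lieComponent_mul_val, hvec]
  rfl

/-- The map `Z̆⁻¹ ∘ J_n ∘ TZ : T Aut(V) → Aut(TV)`, the prolongation of the tautological
representation of `Aut(V)` on `V`; every prolongation factors through it. -/
noncomputable def autProlongation (b : Module.Basis (Fin n) ℝ V)
    (Y : TangentBundle 𝓘(ℝ, V →L[ℝ] V) (Aut V)) : LinearMap.GeneralLinearGroup ℝ (TV V) :=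
  (Zbreve b).symm (J (tangentMap 𝓘(ℝ, V →L[ℝ] V) 𝓘(ℝ, Mat n) (Z b) Y))

theorem autProlongation_apply (b : Module.Basis (Fin n) ℝ V)
    (Y : TangentBundle 𝓘(ℝ, V →L[ℝ] V) (Aut V)) (P : TV V) :
    (autProlongation b Y : TV V →ₗ[ℝ] TV V) P =
      (⟨(Y.proj : V →L[ℝ] V) P.proj,
        (unitsVec Y P.proj + (Y.proj : V →L[ℝ] V) (vec P) : V)⟩ : TV V) := by
  have hlin : (autProlongation b Y : TV V →ₗ[ℝ] TV V) =
      Matrix.toLin (tangentBasis b) (tangentBasis b)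
        (J (tangentMap 𝓘(ℝ, V →L[ℝ] V) 𝓘(ℝ, Mat n) (Z b) Y)) := rfl
  rw [hlin, J_tangentMap_Z, ← map_zero (LinearMap.toMatrix b b), toLin_tangentBasis_fromBlocks,
    LinearMap.zero_apply, add_zero]
  rfl

end AutProlongation

end Prolongation

open Prolongation in
theorem proposition3p9_general {E : Type*} [NormedAddCommGroup E] [NormedSpace ℝ E]
    {H : Type*} [TopologicalSpace H] {I : ModelWithCorners ℝ E H}
    {M : Type*} [TopologicalSpace M] [ChartedSpace H M]
    {V : Type*} [NormedAddCommGroup V] [NormedSpace ℝ V] [FiniteDimensional ℝ V]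
    {n : ℕ} (b : Module.Basis (Fin n) ℝ V) {f : M → Aut V}
    (hf : MDifferentiable I 𝓘(ℝ, V →L[ℝ] V) f) (U : Submodule ℝ V) :
    IsInvariantSubspace (fun x : M => ((f x : V →L[ℝ] V) : V →ₗ[ℝ] V)) U ↔
      IsInvariantSubspace
        (fun X : TangentBundle I M =>
          (autProlongation b (tangentMap I 𝓘(ℝ, V →L[ℝ] V) f X) : TV V →ₗ[ℝ] TV V))
        (tangentSubspace U) := by
  simp only [IsInvariantSubspace, mem_tangentSubspace, autProlongation_apply]
  constructor
  · rintro hU X P ⟨hproj, hvec⟩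
    have hderiv := map_unitsVec_tangentMap_mem_of_eventually_mem U.closed_of_finiteDimensional
      (ContinuousLinearMap.apply ℝ V P.proj) (hf X.proj) (.of_forall fun y => hU y _ hproj)
    exact ⟨hU _ _ hproj, U.add_mem hderiv (hU _ _ hvec)⟩
  · intro hTU x p hp
    exact (hTU ⟨x, (0 : E)⟩ ⟨p, (0 : V)⟩ ⟨hp, U.zero_mem⟩).1

/-- Let `Φ : G → Aut(V)` be a finite-dimensional real representation of a Lie group and `Φ̃` its
prolongation to `TG`. A subspace `U` of `V` is invariant for `Φ` if and only if `TU` is an invariant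
subspace of `TV` for `Φ̃`. -/
theorem proposition3p9 {E : Type*} [NormedAddCommGroup E] [NormedSpace ℝ E]
    {H : Type*} [TopologicalSpace H] {I : ModelWithCorners ℝ E H}
    {G : Type*} [TopologicalSpace G] [ChartedSpace H G] [Group G] [LieGroup I ∞ G]
    {V : Type*} [NormedAddCommGroup V] [NormedSpace ℝ V] [FiniteDimensional ℝ V]
    {n : ℕ} (b : Module.Basis (Fin n) ℝ V)
    (Φ : ContMDiffMonoidMorphism I 𝓘(ℝ, V →L[ℝ] V) ∞ G (Prolongation.Aut V))
    (U : Submodule ℝ V) :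
    Prolongation.IsInvariantSubspace (fun a : G => ((Φ a : V →L[ℝ] V) : V →ₗ[ℝ] V)) U ↔
      Prolongation.IsInvariantSubspace
        (fun X : TangentBundle I G =>
          (Prolongation.prolongation b Φ X : Prolongation.TV V →ₗ[ℝ] Prolongation.TV V))
        (Prolongation.tangentSubspace U) := by
  exact proposition3p9_general b (Φ.contMDiff_toFun.mdifferentiable (by simp)) U
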